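/- Let $s,k\ge 2$ and let $sk+1\le n\le s(k+1)-2$. Call a subset $S\subseteq[n]=\{1,\dots,n\}$ $s$-stable if $s\le|i-j|\le n-s$ for all distinct $i,j\in S$. Let $G=\mathrm{KG}(n,k)_{s\text{-stab}}$ be the $s$-stable Kneser graph: its vertices are the $s$-stable $k$-subsets of $[n]$, two vertices being adjacent if and only if they are disjoint. A shift of $G$ is an automorphism $\phi$ of $G$ such that $\phi(v)$ is adjacent to $v$ for every vertex $v$. Let $\sigma$ denote the automorphism of $G$ induced by the circular permutation $(1,2,\dots,n)$ of $[n]$, i.e. $\sigma(\{i_1,\dots,i_k\})=\{i_1+1,\dots,i_k+1\}$ with $n+1$ read as $1$, and let $\sigma^i$ be its $i$-th power. Put $r=n-sk$, and let $[0]=\emptyset$. Then the shifts of $G$ are exactly the rotations $\sigma^i$ with $$i\in\{1,\dots,s-1\}\cup\{n-s+1,\dots,n-1\}\cup\bigcup_{m\in[k-2]}\{ms+r+1,\dots,(m+1)s-1\}.$$ -/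

import Mathlib

/-- A subset `S` of the `n`-cycle `{0, …, n-1}` is `s`-stable if any two distinct elements `i, j`
of `S` satisfy `s ≤ |i - j| ≤ n - s`. -/
def IsStable {n : ℕ} (s : ℕ) (S : Finset (Fin n)) : Prop :=
  ∀ i ∈ S, ∀ j ∈ S, i ≠ j →
    (s : ℤ) ≤ |(i : ℤ) - (j : ℤ)| ∧ |(i : ℤ) - (j : ℤ)| ≤ (n : ℤ) - (s : ℤ)

/-- The Kneser graph `KG(n, k)`: the vertices are the `k`-subsets of an `n`-set, and two distinct
vertices are adjacent if they are disjoint. -/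
def kneserGraph (n k : ℕ) : SimpleGraph {A : Finset (Fin n) // A.card = k} where
  Adj A B := A ≠ B ∧ Disjoint A.1 B.1
  symm := ⟨fun _ _ h => ⟨h.1.symm, h.2.symm⟩⟩
  loopless := ⟨fun _ h => h.1 rfl⟩

/-- The vertices of the `s`-stable Kneser graph: the `s`-stable `k`-subsets. -/
def stableVertices (n k s : ℕ) : Set {A : Finset (Fin n) // A.card = k} :=
  {A | IsStable s A.1}

/-- The `s`-stable Kneser graph: the subgraph of `KG(n, k)` induced by the `s`-stable vertices. -/
def stableKneserGraph (n k s : ℕ) : SimpleGraph (stableVertices n k s) :=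
  (kneserGraph n k).induce (stableVertices n k s)

/-- A shift of a graph is an automorphism that maps every vertex to one of its neighbours. -/
def SimpleGraph.IsShift {V : Type*} (G : SimpleGraph V) (φ : G ≃g G) : Prop :=
  ∀ u, G.Adj u (φ u)

theorem finRotate_dist_iff {n : ℕ} (s : ℕ) (i j : Fin n) :
    ((s : ℤ) ≤ |((finRotate n i : Fin n) : ℤ) - ((finRotate n j : Fin n) : ℤ)| ∧
      |((finRotate n i : Fin n) : ℤ) - ((finRotate n j : Fin n) : ℤ)| ≤ (n : ℤ) - (s : ℤ)) ↔
    ((s : ℤ) ≤ |(i : ℤ) - (j : ℤ)| ∧ |(i : ℤ) - (j : ℤ)| ≤ (n : ℤ) - (s : ℤ)) := by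
  cases n with
  | zero => exact i.elim0
  | succ n =>
    have hi := i.isLt
    have hj := j.isLt
    rw [coe_finRotate, coe_finRotate]
    simp only [Fin.ext_iff, Fin.val_last]
    split_ifs <;> push_cast <;> simp only [abs_le, le_abs] <;> omega

theorem isStable_map_finRotate {n : ℕ} (s : ℕ) (S : Finset (Fin n)) :
    IsStable s S ↔ IsStable s (S.map (finRotate n).toEmbedding) := by
  simp only [IsStable, Finset.forall_mem_map, Equiv.coe_toEmbedding, finRotate_dist_iff,
    ne_eq, EmbeddingLike.apply_eq_iff_eq]

/-- The action of the circular permutation `σ = (0, 1, …, n - 1)` on `k`-subsets,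
`{i₁, …, iₖ} ↦ {σ i₁, …, σ iₖ}`. -/
def rotateSubsets (n k : ℕ) :
    {A : Finset (Fin n) // A.card = k} ≃ {A : Finset (Fin n) // A.card = k} :=
  (finRotate n).finsetCongr.subtypeEquiv fun A => by
    simp [Equiv.finsetCongr_apply]

/-- The automorphism of the `s`-stable Kneser graph induced by the circular permutation `σ`. Its
`i`-th power in the automorphism group is the rotation `σ ^ i`. -/
def stableRotation (n k s : ℕ) : stableKneserGraph n k s ≃g stableKneserGraph n k s where
  toEquiv := (rotateSubsets n k).subtypeEquiv fun A => isStable_map_finRotate s A.1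
  map_rel_iff' := by
    intro A B
    simp [stableKneserGraph, kneserGraph, rotateSubsets, Subtype.ext_iff]

/-- The `i`-th power of the rotation acts on vertices by taking images under `σ ^ i`. -/
theorem stableRotation_pow_apply (n k s i : ℕ) (v : stableVertices n k s) :
    (((stableRotation n k s ^ i) v).1.1 : Finset (Fin n)) =
      v.1.1.map (finRotate n ^ i : Equiv.Perm (Fin n)).toEmbedding := by
  induction i with
  | zero => simp only [pow_zero]; exact (Finset.map_refl).symm
  | succ i ih =>
    rw [pow_succ', pow_succ']
    have h : ((stableRotation n k s * stableRotation n k s ^ i) v).1.1 =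
        ((stableRotation n k s ^ i) v).1.1.map (finRotate n).toEmbedding := rfl
    rw [h, ih, Finset.map_map]
    rfl

/-!
Write `n = s * k + r` with `1 ≤ r < s`. The preimage in `ℤ` of an `s`-stable `k`-set is an
`n`-periodic set with gaps at least `s`, hence with total slack `r < s` in a period. As `r < s`, the
elements of such a set can be counted accurately: an interval of `L * s` integers contains at most
`L` of them. Hence two elements `m` steps apart differ by an amount in `[m * s, m * s + r]`
(`IsSpaced.exists_steps`), and once all the slack is used between two elements, the rest of the
period is an arithmetic progression of difference `s` (`IsSpaced.mem_of_tight`).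

*Automorphisms come from permutations of the cycle.* This is an Erdős–Ko–Rado theorem with
uniqueness, proved by Katona's averaging. Rotations of a vertex by fewer than `s` steps are disjoint
from it, so the rotations carrying a vertex into a given intersecting family are at least `s` apart,
and there are at most `k` of them in a period. A star attains `k` for every vertex, so a family `F`
as large as a star must attain it too. For the vertex `{0, s, …, (k - 1) * s}` this says that `F`
contains the `k` translates of this progression through some point `c`
(`IsSpaced.exists_progression`), and a vertex meeting all of these contains `c`
(`IsSpaced.mem_of_meets`). Thus independent sets as large as stars are contained in stars,
automorphisms permute the stars, and each is induced by a permutation `π` of the cycle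
(`exists_perm`).

*The permutation is a rotation or a reflection.* A point of some vertex can be replaced by another
point, giving a vertex again, exactly when the two are at circular distance at most `r`
(`isMove_iff`). So `π` preserves this relation, and it determines which points are neighbours on the
cycle (`isUnitMove_succ`, `eq_of_isUnitMove`), because for distances up to `r` the ranges of two
points differ by a single point on each side only if the points are neighbours.

*Which of these are shifts.* A reflection interchanges the ends of some gap of length `s` or
`s + 1`, so it is not a shift. The rotation by `i` is a shift if and only if no vertex contains two
points at distance `i`, and the distances that occur are those in `[m * s, m * s + r]` with
`1 ≤ m < k`.
-/

/-! ### Spaced periodic sets of integers -/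

open Classical in
/-- The number of elements of `P` in the window `[a, b)`. -/
noncomputable def windowCount (P : Set ℤ) (a b : ℤ) : ℕ :=
  ((Finset.Ico a b).filter (· ∈ P)).card

theorem windowCount_add (P : Set ℤ) {a b c : ℤ} (hab : a ≤ b) (hbc : b ≤ c) :
    windowCount P a b + windowCount P b c = windowCount P a c := by
  classical
  unfold windowCount
  rw [← Finset.Ico_union_Ico_eq_Ico hab hbc, Finset.filter_union, Finset.card_union_of_disjoint]
  exact Finset.disjoint_filter_filter (Finset.Ico_disjoint_Ico_consecutive a b c)

theorem windowCount_eq_zero {P : Set ℤ} {a b : ℤ} (h : ∀ x, a ≤ x → x < b → x ∉ P) :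
    windowCount P a b = 0 := by
  classical
  unfold windowCount
  rw [Finset.card_eq_zero, Finset.filter_eq_empty_iff]
  intro x hx
  rw [Finset.mem_Ico] at hx
  exact h x hx.1 hx.2

theorem windowCount_succ_of_mem {P : Set ℤ} {a : ℤ} (h : a ∈ P) :
    windowCount P a (a + 1) = 1 := by
  classical
  unfold windowCount
  rw [Finset.card_eq_one]
  refine ⟨a, ?_⟩
  ext x
  simp only [Finset.mem_filter, Finset.mem_Ico, Finset.mem_singleton]
  constructor
  · rintro ⟨h, -⟩; omega
  · rintro rfl; exact ⟨by omega, h⟩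

theorem windowCount_succ_of_notMem {P : Set ℤ} {a : ℤ} (h : a ∉ P) :
    windowCount P a (a + 1) = 0 :=
  windowCount_eq_zero fun x h₁ h₂ => by
    obtain rfl : x = a := by omega
    exact h

theorem windowCount_translate (P : Set ℤ) (t a b : ℤ) :
    windowCount {x | x - t ∈ P} a b = windowCount P (a - t) (b - t) := by
  classical
  unfold windowCount
  refine Finset.card_bij (fun x _ => x - t) ?_ ?_ ?_
  · intro x hx
    simp only [Finset.mem_filter, Finset.mem_Ico, Set.mem_ofPred_eq] at hx ⊢
    exact ⟨by omega, hx.2⟩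
  · intro x _ y _ h
    simpa using h
  · intro y hy
    simp only [Finset.mem_filter, Finset.mem_Ico] at hy
    refine ⟨y + t, ?_, by ring⟩
    simp only [Finset.mem_filter, Finset.mem_Ico, Set.mem_ofPred_eq, add_sub_cancel_right]
    exact ⟨by omega, hy.2⟩

/-- A window of length `L * s` contains at most `L` elements of a set with gaps at least `s`. -/
theorem windowCount_le {P : Set ℤ} {s : ℕ} (hs : 0 < s)
    (sep : ∀ x ∈ P, ∀ y ∈ P, x < y → x + s ≤ y) {a b : ℤ} (L : ℕ) (hb : b ≤ a + L * s) :
    windowCount P a b ≤ L := by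
  classical
  unfold windowCount
  have hs' : (0 : ℤ) < s := by exact_mod_cast hs
  -- Each of the `L` blocks of length `s` covering the window holds at most one element.
  have key : ∀ x ∈ P, ∀ y ∈ P, x < y → (x - a) / s < (y - a) / s := by
    intro x hx y hy h
    have := sep x hx y hy h
    rw [Int.lt_iff_add_one_le, ← Int.add_mul_ediv_right _ _ hs'.ne']
    exact Int.ediv_le_ediv hs' (by omega)
  have h := Finset.card_le_card_of_injOn (s := (Finset.Ico a b).filter (· ∈ P))
    (t := Finset.Ico (0 : ℤ) L) (fun x => (x - a) / s) ?_ ?_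
  · simpa using h
  · intro x hx
    simp only [Finset.coe_filter, Finset.mem_Ico, Set.mem_ofPred_eq, Finset.coe_Ico,
      Set.mem_Ico] at hx ⊢
    exact ⟨Int.ediv_nonneg (by omega) hs'.le, Int.ediv_lt_of_lt_mul hs' (by omega)⟩
  · intro x hx y hy hxy
    simp only [Finset.coe_filter, Finset.mem_Ico, Set.mem_ofPred_eq] at hx hy
    rcases lt_trichotomy x y with h | h | h
    · exact absurd hxy (key x hx.2 y hy.2 h).ne
    · exact h
    · exact absurd hxy (key y hy.2 x hx.2 h).ne'

theorem periodic_add_mul {P : Set ℤ} {n : ℕ} (per : ∀ x : ℤ, x + n ∈ P ↔ x ∈ P) (q x : ℤ) :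
    x + q * n ∈ P ↔ x ∈ P := by
  induction q with
  | zero => simp
  | succ i ih =>
    rw [← ih, ← per (x + i * n)]
    ring_nf
  | pred i ih =>
    rw [← ih, ← per (x + (-i - 1) * n)]
    ring_nf

theorem windowCount_period {P : Set ℤ} {n : ℕ} (per : ∀ x : ℤ, x + n ∈ P ↔ x ∈ P) (a : ℤ) :
    windowCount P a (a + n) = windowCount P 0 n := by
  have step : ∀ a, windowCount P (a + 1) (a + 1 + n) = windowCount P a (a + n) := by
    intro a
    have h₁ := windowCount_add P (show a ≤ a + 1 by omega) (show a + 1 ≤ a + 1 + n by omega)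
    have h₂ := windowCount_add P (show a ≤ a + n by omega) (show a + n ≤ a + n + 1 by omega)
    have h₃ : windowCount P (a + n) (a + n + 1) = windowCount P a (a + 1) := by
      by_cases h : a ∈ P
      · rw [windowCount_succ_of_mem h, windowCount_succ_of_mem ((per a).2 h)]
      · rw [windowCount_succ_of_notMem h, windowCount_succ_of_notMem (mt (per a).1 h)]
    rw [show a + 1 + (n : ℤ) = a + n + 1 by ring] at *
    omega
  induction a with
  | zero => simp
  | succ i ih => rw [step, ih]
  | pred i ih => rw [← ih, ← step (-i - 1)]; ring_nf

/-- An `n`-periodic set of integers whose distinct elements are at least `s` apart and which has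
`k` elements in each period. These are the preimages in `ℤ` of the `s`-stable `k`-subsets of the
`n`-cycle. -/
structure IsSpaced (n k s : ℕ) (P : Set ℤ) : Prop where
  per : ∀ x : ℤ, x + n ∈ P ↔ x ∈ P
  sep : ∀ x ∈ P, ∀ y ∈ P, x < y → x + s ≤ y
  card : windowCount P 0 n = k

/-- If a period shorter than `s * (k + 1)` contained `k + 1` elements, the window from one of them to
its translate by `n` would contain `k + 2`. -/
theorem windowCount_period_le {P : Set ℤ} {n k s : ℕ} (hs : 0 < s) (hn : n < s * (k + 1))
    (per : ∀ x : ℤ, x + n ∈ P ↔ x ∈ P) (sep : ∀ x ∈ P, ∀ y ∈ P, x < y → x + s ≤ y) :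
    windowCount P 0 n ≤ k := by
  by_cases h : ∃ x, x ∈ P
  · obtain ⟨x, hx⟩ := h
    rw [← windowCount_period per x]
    have h₁ := windowCount_le hs sep (a := x) (b := x + n + 1) (k + 1) (by
      have : ((n + 1 : ℕ) : ℤ) ≤ (s * (k + 1) : ℕ) := by exact_mod_cast hn
      push_cast at this ⊢
      linarith)
    have h₂ := windowCount_add P (show x ≤ x + n by omega) (show x + n ≤ x + n + 1 by omega)
    have h₃ := windowCount_succ_of_mem ((per x).2 hx)
    omega
  · push Not at h
    rw [windowCount_eq_zero fun x _ _ => h x]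
    exact Nat.zero_le k

namespace IsSpaced

variable {n k s r : ℕ} {P : Set ℤ}

theorem window_eq (h : IsSpaced n k s P) (a : ℤ) : windowCount P a (a + n) = k := by
  rw [windowCount_period h.per, h.card]

theorem translate (h : IsSpaced n k s P) (t : ℤ) : IsSpaced n k s {x | x - t ∈ P} where
  per x := by
    rw [Set.mem_ofPred_eq, Set.mem_ofPred_eq, ← h.per (x - t)]
    ring_nf
  sep x hx y hy hxy := by
    have := h.sep _ hx _ hy (by omega)
    omega
  card := by
    rw [windowCount_translate, ← h.window_eq (0 - t)]
    ring_nf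

/-- A window of length `s + r` cannot be empty, since the remaining `(k - 1) * s` integers of the
period contain at most `k - 1` elements. -/
theorem exists_mem_window (h : IsSpaced n k s P) (hs : 0 < s) (hk : 0 < k) (hn : n = s * k + r)
    (a : ℤ) : ∃ y ∈ P, a ≤ y ∧ y < a + s + r := by
  by_contra! hc
  obtain ⟨k, rfl⟩ : ∃ j, k = j + 1 := ⟨k - 1, by omega⟩
  have hn' : (n : ℤ) = s * (k + 1) + r := by exact_mod_cast hn
  have hks : (0 : ℤ) ≤ s * k := by positivity
  have h₁ : windowCount P a (a + s + r) = 0 :=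
    windowCount_eq_zero fun x hx₁ hx₂ hx => absurd hx₂ (not_lt.2 (hc x hx hx₁))
  have h₂ := windowCount_le hs h.sep (a := a + s + r) (b := a + n) k (by rw [hn']; linarith)
  have h₃ := windowCount_add P (show a ≤ a + s + r by omega)
    (show a + s + r ≤ a + n by rw [hn']; linarith)
  have h₄ := h.window_eq a
  omega

theorem exists_next (h : IsSpaced n k s P) (hs : 0 < s) (hk : 0 < k) (hn : n = s * k + r)
    {x : ℤ} (hx : x ∈ P) : ∃ y ∈ P, x + s ≤ y ∧ y ≤ x + s + r := by
  obtain ⟨y, hy, h₁, h₂⟩ := h.exists_mem_window hs hk hn (x + 1)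
  exact ⟨y, hy, h.sep x hx y hy (by omega), by omega⟩

theorem exists_prev (h : IsSpaced n k s P) (hs : 0 < s) (hk : 0 < k) (hn : n = s * k + r)
    {x : ℤ} (hx : x ∈ P) : ∃ y ∈ P, x - s - r ≤ y ∧ y ≤ x - s := by
  obtain ⟨y, hy, h₁, h₂⟩ := h.exists_mem_window hs hk hn (x - s - r)
  have := h.sep y hy x hx (by omega)
  exact ⟨y, hy, h₁, by omega⟩

/-- If the whole slack `r` of a spaced set is used up between `a` and `a + m * s + r`, then the
remainder of the period, from `a + m * s + r` to `a + n`, is filled in steps of exactly `s`. -/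
theorem mem_of_tight (h : IsSpaced n k s P) (hn : n = s * k + r) (hr : r < s) {a : ℤ} {m i : ℕ}
    (ha : a ∈ P) (hb : a + m * s + r ∈ P) (hmi : m + i ≤ k) : a + m * s + r + i * s ∈ P := by
  have hn' : (n : ℤ) = s * k + r := by exact_mod_cast hn
  have han := (h.per a).2 ha
  have hs : 0 < s := by omega
  have hs' : (0 : ℤ) < s := by exact_mod_cast hs
  set b : ℤ := a + m * s + r with hbdef
  by_contra hc
  obtain ⟨j, hj⟩ : ∃ j, k = m + i + j := ⟨k - (m + i), by omega⟩
  have hjz : (n : ℤ) = m * s + i * s + j * s + r := by rw [hn', hj]; push_cast; ring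
  rcases j with _ | j
  · apply hc
    convert han using 1
    rw [hjz, hbdef]; push_cast; ring
  push_cast at hjz
  have hms : (0 : ℤ) ≤ m * s := by positivity
  have his : (0 : ℤ) ≤ i * s := by positivity
  have hjs : (0 : ℤ) ≤ j * s := by positivity
  have a₁ := windowCount_add P (show a ≤ b by omega) (show b ≤ b + 1 by omega)
  have c₁ := windowCount_le hs h.sep (a := a) (b := b + 1) (m + 1) (by push_cast; linarith)
  have c₂ := windowCount_succ_of_mem hb
  have c₃ := windowCount_le hs h.sep (a := b) (b := b + i * s) i le_rfl
  have c₄ := windowCount_succ_of_notMem hc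
  have c₅ := windowCount_le hs h.sep (a := b + i * s + 1) (b := a + n + 1) (j + 1)
    (by push_cast; linarith)
  have c₆ := windowCount_succ_of_mem han
  have c₇ := h.window_eq a
  have a₂ := windowCount_add P (show a ≤ b by omega) (show b ≤ b + i * s by omega)
  have a₃ := windowCount_add P (show a ≤ b + i * s by omega)
    (show b + i * s ≤ b + i * s + 1 by omega)
  have a₄ := windowCount_add P (show a ≤ b + i * s + 1 by omega)
    (show b + i * s + 1 ≤ a + n by linarith)
  have a₅ := windowCount_add P (show b + i * s + 1 ≤ a + n by linarith)
    (show a + n ≤ a + n + 1 by omega)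
  omega

/-- The difference of two elements of a spaced set lies in one of the intervals
`[m * s, m * s + r]`, where `m` counts the steps between them. -/
theorem exists_steps (h : IsSpaced n k s P) (hs : 0 < s) (hn : n = s * k + r) {x y : ℤ}
    (hx : x ∈ P) (hy : y ∈ P) (hxy : x < y) (hyn : y < x + n) :
    ∃ m : ℕ, 1 ≤ m ∧ m + 1 ≤ k ∧ (m * s : ℤ) ≤ y - x ∧ y - x ≤ m * s + r := by
  have hn' : (n : ℤ) = s * k + r := by exact_mod_cast hn
  have a₁ := windowCount_add P hxy.le hyn.le
  have a₂ := windowCount_add P (show x ≤ x + 1 by omega) (show x + 1 ≤ y by omega)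
  have a₃ := windowCount_add P (show y ≤ y + 1 by omega) (show y + 1 ≤ x + n by omega)
  have a₄ := windowCount_add P hxy.le (show y ≤ y + 1 by omega)
  have a₅ := windowCount_add P hyn.le (show x + n ≤ x + n + 1 by omega)
  have c₁ := windowCount_succ_of_mem hx
  have c₂ := windowCount_succ_of_mem hy
  have c₃ := windowCount_succ_of_mem ((h.per x).2 hx)
  have c₄ := h.window_eq x
  obtain ⟨j, hj⟩ : ∃ j, k = windowCount P x y + j := ⟨k - windowCount P x y, by omega⟩
  refine ⟨windowCount P x y, by omega, by omega, ?_, ?_⟩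
  · by_contra hc
    have := windowCount_le hs h.sep (a := x) (b := y + 1) (windowCount P x y) (by linarith)
    omega
  · by_contra hc
    have hjz : (k : ℤ) = windowCount P x y + j := by exact_mod_cast hj
    rw [hjz] at hn'
    have := windowCount_le hs h.sep (a := y) (b := x + n + 1) j (by linarith)
    omega

end IsSpaced

/-- The set with gaps `s` throughout each period starting at `c`, except that the elements from the
`m`-th on are moved forward by `t`. -/
def steppedSet (n k s m t : ℕ) (c : ℤ) : Set ℤ :=
  {x | ∃ j : ℕ, j < k ∧ ∃ q : ℤ, x = c + (j * s + if m ≤ j then t else 0 : ℕ) + q * n}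

theorem isSpaced_steppedSet {n k s r : ℕ} (m : ℕ) {t : ℕ} (c : ℤ) (hn : n = s * k + r)
    (hr : r < s) (ht : t ≤ r) : IsSpaced n k s (steppedSet n k s m t c) := by
  set f : ℕ → ℕ := fun j => j * s + if m ≤ j then t else 0 with hf
  have hs : 0 < s := by omega
  have mono : ∀ {i j}, i < j → f i + s ≤ f j := by
    intro i j hij
    have : (i + 1) * s ≤ j * s := Nat.mul_le_mul_right s hij
    have h₂ : (i + 1) * s = i * s + s := by ring
    simp only [hf]
    split_ifs <;> omega
  have le : ∀ {j}, j < k → f j + s ≤ n := by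
    intro j hj
    have : (j + 1) * s ≤ k * s := Nat.mul_le_mul_right s hj
    have h₂ : (j + 1) * s = j * s + s := by ring
    have h₃ : k * s = s * k := by ring
    simp only [hf]
    split_ifs <;> omega
  have per : ∀ x : ℤ, x + n ∈ steppedSet n k s m t c ↔ x ∈ steppedSet n k s m t c := by
    intro x
    constructor
    · rintro ⟨j, hj, q, hq⟩
      exact ⟨j, hj, q - 1, by linarith⟩
    · rintro ⟨j, hj, q, hq⟩
      exact ⟨j, hj, q + 1, by linarith⟩
  have sep : ∀ x ∈ steppedSet n k s m t c, ∀ y ∈ steppedSet n k s m t c, x < y → x + s ≤ y := by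
    rintro x ⟨i, hi, p, hx⟩ y ⟨j, hj, q, hy⟩ hxy
    change x = c + (f i : ℕ) + p * n at hx
    change y = c + (f j : ℕ) + q * n at hy
    have h₁ : (f i : ℤ) + s ≤ n := by exact_mod_cast le hi
    have h₂ : (f j : ℤ) + s ≤ n := by exact_mod_cast le hj
    have h₃ : (0 : ℤ) ≤ f i := by positivity
    have h₄ : (0 : ℤ) ≤ f j := by positivity
    have h₅ : (0 : ℤ) ≤ n := by positivity
    rcases lt_trichotomy p q with h | rfl | h
    · nlinarith [mul_le_mul_of_nonneg_right (show p + 1 ≤ q from h) h₅]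
    · have : i < j := by
        by_contra hc
        have : f j ≤ f i := by
          rcases (not_lt.1 hc).lt_or_eq with h | h
          · have := mono h; omega
          · rw [h]
        have : (f j : ℤ) ≤ f i := by exact_mod_cast this
        omega
      have : (f i : ℤ) + s ≤ f j := by exact_mod_cast mono this
      omega
    · nlinarith [mul_le_mul_of_nonneg_right (show q + 1 ≤ p from h) h₅]
  refine ⟨per, sep, le_antisymm (windowCount_period_le hs (by rw [hn]; linarith) per sep) ?_⟩
  rw [← windowCount_period per c]
  classical
  unfold windowCount
  have h := Finset.card_le_card_of_injOn (s := Finset.range k)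
    (t := (Finset.Ico c (c + n)).filter (· ∈ steppedSet n k s m t c)) (fun j => c + (f j : ℕ))
    ?_ ?_
  · simpa using h
  · intro j hj
    have hj : j < k := by simpa using hj
    have := le hj
    simp only [Finset.coe_filter, Finset.mem_Ico, Set.mem_ofPred_eq]
    exact ⟨by omega, j, hj, 0, by simp [hf]⟩
  · intro i _ j _ hij
    have hij : f i = f j := by simpa using hij
    rcases lt_trichotomy i j with h | h | h
    · have := mono h; omega
    · exact h
    · have := mono h; omega

theorem mem_steppedSet_of_lt {n k s m t : ℕ} (c : ℤ) {j : ℕ} (hj : j < k) (hm : j < m) :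
    c + j * s ∈ steppedSet n k s m t c :=
  ⟨j, hj, 0, by simp [not_le.2 hm]⟩

theorem mem_steppedSet_of_le {n k s m t : ℕ} (c : ℤ) {j : ℕ} (hj : j < k) (hm : m ≤ j) :
    c + j * s + t ∈ steppedSet n k s m t c :=
  ⟨j, hj, 0, by simp [hm]; ring⟩

/-- If all differences in a spaced set `T` are differences of the arithmetic progression
`0, s, …, (k - 1) * s` modulo `n`, then `T` contains such a progression. -/
theorem IsSpaced.exists_progression {n k s r : ℕ} {T : Set ℤ} (h : IsSpaced n k s T) (hk : 2 ≤ k)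
    (hn : n = s * k + r) (hr : r < s)
    (hT : ∀ x ∈ T, ∀ y ∈ T, ∃ i j : ℕ, ∃ q : ℤ, i < k ∧ j < k ∧
      y - x = (i - j : ℤ) * s + q * n) :
    ∃ t₀ : ℤ, ∀ j : ℕ, j < k → t₀ + j * s ∈ T := by
  have hn' : (n : ℤ) = s * k + r := by exact_mod_cast hn
  have hs : 0 < s := by omega
  obtain ⟨t, ht, -⟩ := h.exists_mem_window hs (by omega) hn 0
  by_cases hall : ∀ j : ℕ, j < k → t + j * s ∈ T
  · exact ⟨t, hall⟩
  push Not at hall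
  classical
  -- At the first failure the next gap is longer than `s`, hence it is `s + r`.
  obtain ⟨hj, hjT⟩ := Nat.find_spec hall
  have hmin := fun i => Nat.find_min hall (m := i)
  generalize Nat.find hall = j at *
  rcases j with _ | j
  · simp [ht] at hjT
  have hy : t + j * s ∈ T := by
    by_contra hc
    exact hmin j (by omega) ⟨by omega, hc⟩
  obtain ⟨y, hyT, hy₁, hy₂⟩ := h.exists_next hs (by omega) hn hy
  have hne : y ≠ t + j * s + s := by
    rintro rfl
    apply hjT
    push_cast
    convert hyT using 1
    ring
  have hyr : y = t + j * s + (1 : ℕ) * s + r := by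
    obtain ⟨p, p', q, hp, hp', hq⟩ := hT _ hy _ hyT
    have hpk : (p : ℤ) + 1 ≤ k := by exact_mod_cast hp
    have hpk' : (p' : ℤ) + 1 ≤ k := by exact_mod_cast hp'
    have hp0 : (0 : ℤ) ≤ p := by positivity
    have hp0' : (0 : ℤ) ≤ p' := by positivity
    have hk' : (2 : ℤ) ≤ k := by exact_mod_cast hk
    have hrs : (r : ℤ) + 1 ≤ s := by exact_mod_cast hr
    have hr0 : (0 : ℤ) ≤ r := by positivity
    set e : ℤ := y - (t + j * s) - s with he
    have he₁ : 1 ≤ e := by omega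
    have he₂ : e ≤ r := by omega
    have hM : s + e = (p - p' + q * k) * s + q * r := by rw [hn'] at hq; linarith
    have her : e = r := by
      generalize hMM : (p - p' + q * k : ℤ) = M at hM
      have hMs {m : ℤ} (hm : m ≤ M) : m * s ≤ M * s :=
        mul_le_mul_of_nonneg_right hm (by positivity)
      have hsM {m : ℤ} (hm : M ≤ m) : M * s ≤ m * s :=
        mul_le_mul_of_nonneg_right hm (by positivity)
      rcases lt_trichotomy q 1 with h1 | rfl | h1
      · rcases (show q ≤ -1 ∨ q = 0 by omega) with h0 | rfl
        · have h2 : q * k ≤ -1 * k := mul_le_mul_of_nonneg_right h0 (by positivity)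
          have h3 : q * r ≤ 0 * r := mul_le_mul_of_nonneg_right (by omega) hr0
          have := hsM (m := -1) (by linarith)
          linarith
        · rcases le_or_gt M 1 with h2 | h2
          · have := hsM h2
            linarith
          · have := hMs (m := 2) h2
            linarith
      · rcases (show M = 1 ∨ 2 ≤ M by omega) with rfl | h2
        · linarith
        · have := hMs h2
          linarith
      · have h2 : 2 * (k : ℤ) ≤ q * k := mul_le_mul_of_nonneg_right h1 (by positivity)
        have h3 : 0 * (r : ℤ) ≤ q * r := mul_le_mul_of_nonneg_right (by omega) hr0
        have := hMs (m := 3) (by linarith)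
        linarith
    push_cast
    omega
  subst hyr
  exact ⟨_, fun i hi => h.mem_of_tight hn hr hy hyT (by omega)⟩

/-- A spaced set that meets all the progressions `t₀ + j * s, …, t₀ + (j + k - 1) * s` with `j < k`
contains their common element `t₀ + (k - 1) * s`. -/
theorem IsSpaced.mem_of_meets {n k s r : ℕ} {U : Set ℤ} (h : IsSpaced n k s U) (hk : 0 < k)
    (hn : n = s * k + r) (hr : r < s) {t₀ : ℤ}
    (hU : ∀ j : ℕ, j < k → ∃ l : ℕ, j ≤ l ∧ l < j + k ∧ t₀ + l * s ∈ U) :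
    t₀ + (k - 1 : ℕ) * s ∈ U := by
  classical
  have hn' : (n : ℤ) = s * k + r := by exact_mod_cast hn
  obtain ⟨l₀, -, hl₀, hm₀⟩ := hU 0 hk
  -- Take the last term up to `k - 1` of the progression that lies in `U`.
  have hle := Nat.findGreatest_le (P := fun l : ℕ => t₀ + l * s ∈ U) (k - 1)
  have hspec := Nat.findGreatest_spec (P := fun l : ℕ => t₀ + l * s ∈ U) (n := k - 1) (m := l₀)
    (by omega) hm₀
  have hgr := fun l => Nat.findGreatest_is_greatest (P := fun l : ℕ => t₀ + l * s ∈ U)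
    (n := k - 1) (k := l)
  generalize Nat.findGreatest (fun l : ℕ => t₀ + l * s ∈ U) (k - 1) = a at *
  rcases hle.lt_or_eq with hlt | rfl
  · obtain ⟨l, hl₁, hl₂, hl⟩ := hU (a + 1) (by omega)
    have hkl : k ≤ l := by
      by_contra hc
      exact hgr l (by omega) (by omega) hl
    have hlow : t₀ + (l - k : ℤ) * s - r ∈ U := by
      rw [← h.per]
      convert hl using 1
      rw [hn']; ring
    have hcast : ((a + k - l : ℕ) : ℤ) = a + k - l := by
      rw [Nat.cast_sub (by omega)]; push_cast; ring
    have := h.mem_of_tight hn hr (m := a + k - l) (i := k - 1 - a) hlow (by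
      convert hspec using 1
      rw [hcast]; ring) (by omega)
    convert this using 1
    have h₂ : ((k - 1 : ℕ) : ℤ) = (k - 1 - a : ℕ) + a := by omega
    rw [hcast, h₂]; ring
  · exact hspec

/-! ### Vertices as spaced sets -/

section Vertices

variable {n k s r : ℕ} [NeZero n]

/-- The residue of an integer, as a point of the `n`-cycle. -/
def cyc (n : ℕ) [NeZero n] (x : ℤ) : Fin n :=
  ⟨(x % n).toNat, by
    have hn : (0 : ℤ) < n := by exact_mod_cast Nat.pos_of_neZero n
    have h₁ := Int.emod_nonneg x hn.ne'
    have h₂ := Int.emod_lt_of_pos x hn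
    omega⟩

theorem coe_cyc (x : ℤ) : ((cyc n x : ℕ) : ℤ) = x % n := by
  have hn : (0 : ℤ) < n := by exact_mod_cast Nat.pos_of_neZero n
  simp [cyc, Int.emod_nonneg x hn.ne']

theorem cyc_coe (i : Fin n) : cyc n (i : ℕ) = i := by
  apply Fin.ext
  have := coe_cyc (n := n) (i : ℕ)
  rw [Int.emod_eq_of_lt (by positivity) (by exact_mod_cast i.isLt)] at this
  exact_mod_cast this

theorem cyc_eq_cyc {x y : ℤ} : cyc n x = cyc n y ↔ ∃ q : ℤ, y = x + q * n := by
  rw [Fin.ext_iff, ← Int.natCast_inj, coe_cyc, coe_cyc]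
  change x ≡ y [ZMOD n] ↔ _
  rw [Int.modEq_iff_dvd]
  constructor
  · rintro ⟨q, hq⟩
    exact ⟨q, by linarith⟩
  · rintro ⟨q, hq⟩
    exact ⟨q, by linarith⟩

theorem cyc_add_period (x : ℤ) : cyc n (x + n) = cyc n x :=
  (cyc_eq_cyc.2 ⟨1, by ring⟩).symm

theorem finRotate_cyc (x : ℤ) : finRotate n (cyc n x) = cyc n (x + 1) := by
  cases n with
  | zero => exact (NeZero.ne 0 rfl).elim
  | succ m =>
    apply Fin.ext
    rw [← Int.natCast_inj, coe_cyc, coe_finRotate, ← Int.emod_add_emod]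
    have h := coe_cyc (n := m + 1) x
    have hlt := (cyc (m + 1) x).isLt
    rw [← h]
    simp only [Fin.ext_iff, Fin.val_last]
    split_ifs with hc
    · rw [hc]; simp
    · rw [Int.emod_eq_of_lt (by positivity) (by omega)]
      simp

/-- The preimage in `ℤ` of a vertex of the stable Kneser graph. -/
def lift (v : stableVertices n k s) : Set ℤ := {x | cyc n x ∈ v.1.1}

theorem mem_lift {v : stableVertices n k s} {x : ℤ} : x ∈ lift v ↔ cyc n x ∈ v.1.1 := Iff.rfl

theorem lift_injective {u v : stableVertices n k s} (h : lift u = lift v) : u = v := by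
  apply Subtype.ext
  apply Subtype.ext
  ext i
  rw [← cyc_coe i]
  exact Set.ext_iff.1 h (i : ℕ)

theorem windowCount_preimage {P : Set ℤ} {S : Finset (Fin n)} (hP : ∀ x, x ∈ P ↔ cyc n x ∈ S) :
    windowCount P 0 n = S.card := by
  classical
  unfold windowCount
  refine Finset.card_bij (fun x _ => cyc n x) ?_ ?_ ?_
  · intro x hx
    exact (hP x).1 (Finset.mem_filter.1 hx).2
  · intro x hx y hy hxy
    have hx := Finset.mem_Ico.1 (Finset.mem_filter.1 hx).1
    have hy := Finset.mem_Ico.1 (Finset.mem_filter.1 hy).1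
    have := congrArg (fun i : Fin n => ((i : ℕ) : ℤ)) hxy
    simp only [coe_cyc] at this
    rwa [Int.emod_eq_of_lt hx.1 hx.2, Int.emod_eq_of_lt hy.1 hy.2] at this
  · intro i hi
    refine ⟨(i : ℕ), ?_, cyc_coe i⟩
    simp only [Finset.mem_filter, Finset.mem_Ico, hP, cyc_coe]
    exact ⟨⟨by positivity, by exact_mod_cast i.isLt⟩, hi⟩

/-- A subset of the cycle is `s`-stable exactly when distinct elements of its preimage in `ℤ` are at
least `s` apart. -/
theorem isStable_iff (hn : s ≤ n) (S : Finset (Fin n)) :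
    IsStable s S ↔ ∀ x : ℤ, cyc n x ∈ S → ∀ y : ℤ, cyc n y ∈ S → x < y → x + s ≤ y := by
  have hn' : (s : ℤ) ≤ n := by exact_mod_cast hn
  have hn0 : (0 : ℤ) ≤ n := by positivity
  constructor
  · intro h x hx y hy hxy
    by_cases hc : cyc n x = cyc n y
    · obtain ⟨q, rfl⟩ := cyc_eq_cyc.1 hc
      have hq : 1 ≤ q := by
        by_contra hq
        have : q * n ≤ 0 * n := mul_le_mul_of_nonneg_right (by omega) hn0
        omega
      have : 1 * n ≤ q * n := mul_le_mul_of_nonneg_right hq hn0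
      omega
    · obtain ⟨h₁, h₂⟩ := h _ hx _ hy hc
      rw [coe_cyc, coe_cyc] at h₁ h₂
      have hx' := Int.emod_add_mul_ediv x n
      have hy' := Int.emod_add_mul_ediv y n
      rw [abs_le] at h₂
      have hd : y - x = (y % n - x % n) + n * (y / n - x / n) := by linarith
      rcases lt_trichotomy (y / n - x / n) 0 with hq | hq | hq
      · have : n * (y / n - x / n) ≤ n * (-1) := mul_le_mul_of_nonneg_left (by omega) hn0
        omega
      · rw [hq] at hd
        rcases le_abs.1 h₁ with h₁ | h₁ <;> omega
      · have : (n : ℤ) * 1 ≤ n * (y / n - x / n) := mul_le_mul_of_nonneg_left (by omega) hn0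
        omega
  · intro h
    have key : ∀ i ∈ S, ∀ j ∈ S, i < j → (i : ℤ) + s ≤ j ∧ (j : ℤ) + s ≤ i + n := by
      intro i hi j hj hij
      have hij' : (i : ℕ) < j := hij
      have := i.isLt
      have := j.isLt
      rw [← cyc_coe i] at hi
      rw [← cyc_coe j] at hj
      exact ⟨h _ hi _ hj (by omega), h _ hj _ (by rwa [cyc_add_period]) (by omega)⟩
    intro i hi j hj hij
    rw [abs_le, le_abs]
    rcases lt_or_gt_of_ne hij with hlt | hlt
    · have := key i hi j hj hlt
      omega
    · have := key j hj i hi hlt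
      omega

theorem isSpaced_lift (hn : s ≤ n) (v : stableVertices n k s) : IsSpaced n k s (lift v) where
  per x := by rw [mem_lift, mem_lift, cyc_add_period]
  sep := (isStable_iff hn v.1.1).1 v.2
  card := (windowCount_preimage fun _ => Iff.rfl).trans v.1.2

theorem exists_lift_eq (hn : s ≤ n) {P : Set ℤ} (hP : IsSpaced n k s P) :
    ∃ v : stableVertices n k s, lift v = P := by
  classical
  set S : Finset (Fin n) := Finset.univ.filter fun i => ((i : ℕ) : ℤ) ∈ P with hS
  have hSP : {x | cyc n x ∈ S} = P := by
    ext x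
    simp only [hS, Set.mem_ofPred_eq, Finset.mem_filter, Finset.mem_univ, true_and, coe_cyc]
    have := periodic_add_mul hP.per (x / n) (x % n)
    rwa [mul_comm, Int.emod_add_mul_ediv, Iff.comm] at this
  refine ⟨⟨⟨S, ?_⟩, ?_⟩, hSP⟩
  · rw [← windowCount_preimage (P := P) fun x => (Set.ext_iff.1 hSP x).symm, hP.card]
  · refine (isStable_iff hn S).2 fun x hx y hy => ?_
    rw [← hSP] at hP
    exact hP.sep x hx y hy

theorem adj_iff (hk : 0 < k) (u v : stableVertices n k s) :
    (stableKneserGraph n k s).Adj u v ↔ ∀ x ∈ lift u, x ∉ lift v := by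
  change (u.1 ≠ v.1 ∧ Disjoint u.1.1 v.1.1) ↔ _
  rw [Finset.disjoint_left]
  constructor
  · rintro ⟨-, h⟩ x hx
    exact h hx
  · intro h
    refine ⟨fun huv => ?_, fun i hi => ?_⟩
    · obtain ⟨i, hi⟩ := Finset.card_pos.1 (u.1.2.symm ▸ hk)
      refine h (i : ℕ) ?_ ?_
      · rwa [mem_lift, cyc_coe]
      · rwa [mem_lift, cyc_coe, ← huv]
    · rw [← cyc_coe i] at hi ⊢
      exact h _ hi

theorem mem_lift_stableRotation (v : stableVertices n k s) (x : ℤ) :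
    x ∈ lift (stableRotation n k s v) ↔ x - 1 ∈ lift v := by
  rw [mem_lift, mem_lift]
  have : cyc n x = finRotate n (cyc n (x - 1)) := by rw [finRotate_cyc]; ring_nf
  change cyc n x ∈ v.1.1.map (finRotate n).toEmbedding ↔ _
  rw [this]
  exact Finset.mem_map' _

theorem mem_lift_zpow (t : ℤ) (v : stableVertices n k s) (x : ℤ) :
    x ∈ lift ((stableRotation n k s ^ t) v) ↔ x - t ∈ lift v := by
  induction t generalizing x with
  | zero => simp
  | succ i ih =>
    rw [add_comm, zpow_one_add, RelIso.mul_apply, mem_lift_stableRotation, ih]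
    ring_nf
  | pred i ih =>
    have h := mem_lift_stableRotation ((stableRotation n k s ^ (-i - 1 : ℤ)) v) (x + 1)
    rw [← RelIso.mul_apply, ← zpow_one_add, add_sub_cancel, add_sub_cancel_right, ih] at h
    rw [← h]
    ring_nf

end Vertices

/-! ### Automorphisms permute the points of the cycle -/

section Stars

variable {n k s r : ℕ}

/-- The rotations carrying `v` into a given family `F` of vertices. -/
def rotationsInto (F : Set (stableVertices n k s)) (v : stableVertices n k s) : Set ℤ :=
  {t | (stableRotation n k s ^ t) v ∈ F}

/-- Double counting of the pairs of a vertex `v` and a rotation carrying `v` into `F`. -/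
theorem sum_windowCount_rotationsInto [Fintype (stableVertices n k s)]
    (F : Finset (stableVertices n k s)) :
    ∑ v, windowCount (rotationsInto (F : Set (stableVertices n k s)) v) 0 n = n * F.card := by
  classical
  have h : ∀ v, windowCount (rotationsInto (F : Set (stableVertices n k s)) v) 0 n =
      ∑ t ∈ Finset.Ico (0 : ℤ) n, if (stableRotation n k s ^ t) v ∈ F then 1 else 0 := by
    intro v
    rw [← Finset.card_filter]
    unfold windowCount
    congr 1
    ext t
    simp [rotationsInto]
  simp_rw [h]
  rw [Finset.sum_comm]
  have h₂ : ∀ t : ℤ, (∑ v, if (stableRotation n k s ^ t) v ∈ F then 1 else 0) = F.card := by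
    intro t
    exact (Equiv.sum_comp (stableRotation n k s ^ t).toEquiv
      (fun v => if v ∈ F then 1 else 0)).trans (by simp)
  simp [h₂]

variable [NeZero n]

theorem rotationsInto_per (F : Set (stableVertices n k s)) (hn : s ≤ n)
    (v : stableVertices n k s) (t : ℤ) :
    t + n ∈ rotationsInto F v ↔ t ∈ rotationsInto F v := by
  have : (stableRotation n k s ^ (t + n)) v = (stableRotation n k s ^ t) v := by
    apply lift_injective
    ext x
    rw [mem_lift_zpow, mem_lift_zpow, ← (isSpaced_lift hn v).per (x - (t + n))]
    ring_nf
  simp only [rotationsInto, Set.mem_ofPred_eq, this]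

/-- Rotations of `v` by amounts differing by less than `s` are disjoint, so at most one of them lies
in an intersecting family. -/
theorem rotationsInto_sep {F : Set (stableVertices n k s)} (hn : s ≤ n)
    (hF : ∀ u ∈ F, ∀ v ∈ F, ∃ x, x ∈ lift u ∧ x ∈ lift v) (v : stableVertices n k s) :
    ∀ t ∈ rotationsInto F v, ∀ t' ∈ rotationsInto F v, t < t' → t + s ≤ t' := by
  intro t ht t' ht' htt
  obtain ⟨x, hx, hx'⟩ := hF _ ht _ ht'
  rw [mem_lift_zpow] at hx hx'
  have := (isSpaced_lift hn v).sep _ hx' _ hx (by omega)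
  omega

/-- An intersecting family which is as large as a star is contained in a star. -/
theorem exists_mem_of_card_eq [Fintype (stableVertices n k s)] (hk : 2 ≤ k)
    (hn : n = s * k + r) (hr : r < s) {F S : Finset (stableVertices n k s)}
    (hF : ∀ u ∈ F, ∀ v ∈ F, ∃ x, x ∈ lift u ∧ x ∈ lift v) {c : ℤ}
    (hS : ∀ v, v ∈ S ↔ c ∈ lift v) (hcard : F.card = S.card) :
    ∃ c', ∀ u ∈ F, c' ∈ lift u := by
  have hs : 0 < s := by omega
  have hsn : s ≤ n := by rw [hn]; nlinarith
  have hle : ∀ v, windowCount (rotationsInto (F : Set (stableVertices n k s)) v) 0 n ≤ k :=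
    fun v => windowCount_period_le hs (by rw [hn]; linarith) (rotationsInto_per _ hsn v)
      (rotationsInto_sep hsn hF v)
  -- Each vertex has exactly `k` rotations containing `c`, hence `k` rotations in `F`.
  have hstar : ∀ v, windowCount (rotationsInto (S : Set (stableVertices n k s)) v) 0 n = k := by
    intro v
    refine le_antisymm (windowCount_period_le hs (by rw [hn]; linarith)
      (rotationsInto_per _ hsn v) (rotationsInto_sep hsn ?_ v)) ?_
    · intro u hu w hw
      exact ⟨c, (hS u).1 hu, (hS w).1 hw⟩
    · classical
      rw [← windowCount_period (rotationsInto_per _ hsn v) (c - (n - 1))]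
      refine (isSpaced_lift hsn v).card.ge.trans ?_
      unfold windowCount
      refine Finset.card_le_card_of_injOn (fun x => c - x) ?_ ?_
      · intro x hx
        simp only [Finset.coe_filter, Finset.mem_Ico, Set.mem_ofPred_eq] at hx ⊢
        refine ⟨by omega, ?_⟩
        change _ ∈ S
        rw [hS, mem_lift_zpow]
        simpa using hx.2
      · intro x _ y _ hxy
        simpa using hxy
  have heq : ∀ v, windowCount (rotationsInto (F : Set (stableVertices n k s)) v) 0 n = k := by
    have h := sum_windowCount_rotationsInto F
    rw [hcard, ← sum_windowCount_rotationsInto S, Finset.sum_congr rfl fun v _ => hstar v] at h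
    intro v
    exact (Finset.sum_eq_sum_iff_of_le fun v _ => hle v).1 h v (Finset.mem_univ v)
  obtain ⟨v, hv⟩ := exists_lift_eq hsn
    (isSpaced_steppedSet 0 (t := 0) 0 hn hr (Nat.zero_le r) : IsSpaced n k s _)
  have hmem : ∀ x, x ∈ lift v ↔ ∃ j : ℕ, j < k ∧ ∃ q : ℤ, x = j * s + q * n := by
    intro x
    rw [hv]
    simp [steppedSet]
  have hT : IsSpaced n k s (rotationsInto (F : Set (stableVertices n k s)) v) :=
    ⟨rotationsInto_per _ hsn v, rotationsInto_sep hsn hF v, heq v⟩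
  obtain ⟨t₀, ht₀⟩ := hT.exists_progression hk hn hr (by
    intro t ht t' ht'
    obtain ⟨x, hx, hx'⟩ := hF _ ht _ ht'
    rw [mem_lift_zpow, hmem] at hx hx'
    obtain ⟨i, hi, p, hp⟩ := hx
    obtain ⟨j, hj, q, hq⟩ := hx'
    exact ⟨i, j, p - q, hi, hj, by linarith⟩)
  refine ⟨_, fun u hu => (isSpaced_lift hsn u).mem_of_meets (by omega) hn hr (t₀ := t₀) ?_⟩
  intro j hj
  obtain ⟨x, hx, hx'⟩ := hF _ (ht₀ j hj) _ hu
  rw [mem_lift_zpow, hmem] at hx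
  obtain ⟨i, hi, q, hq⟩ := hx
  refine ⟨i + j, by omega, by omega, ?_⟩
  rw [← periodic_add_mul (isSpaced_lift hsn u).per q]
  convert hx' using 1
  push_cast
  linarith

/-- An automorphism carries a star to an independent set of the same size, hence into a star. -/
theorem exists_star_image (hk : 2 ≤ k) (hn : n = s * k + r) (hr : r < s)
    (φ : stableKneserGraph n k s ≃g stableKneserGraph n k s) (c : ℤ) :
    ∃ c', ∀ v, c ∈ lift v → c' ∈ lift (φ v) := by
  classical
  have := Fintype.ofFinite (stableVertices n k s)
  set S : Finset (stableVertices n k s) := Finset.univ.filter fun v => c ∈ lift v with hS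
  have hS' : ∀ v, v ∈ S ↔ c ∈ lift v := by simp [hS]
  obtain ⟨c', hc'⟩ := exists_mem_of_card_eq hk hn hr (F := S.map φ.toEquiv.toEmbedding) (S := S)
    (c := c) (by
      simp only [Finset.mem_map, forall_exists_index, and_imp]
      rintro _ u hu rfl _ v hv rfl
      by_contra! hc
      have h := (adj_iff (by omega) (φ u) (φ v)).2 hc
      rw [φ.map_adj_iff, adj_iff (by omega)] at h
      exact h c ((hS' u).1 hu) ((hS' v).1 hv)) hS' (Finset.card_map _)
  exact ⟨c', fun v hv => hc' _ (Finset.mem_map_of_mem _ ((hS' v).2 hv))⟩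

/-- Different points have incomparable stars. -/
theorem cyc_eq_of_star_subset (hk : 2 ≤ k) (hn : n = s * k + r) (hr₁ : 1 ≤ r) (hr : r < s)
    {c c' : ℤ} (h : ∀ v : stableVertices n k s, c ∈ lift v → c' ∈ lift v) :
    cyc n c = cyc n c' := by
  have hsn : s ≤ n := by rw [hn]; nlinarith
  have hn' : (n : ℤ) = s * k + r := by exact_mod_cast hn
  -- The progressions starting and ending at `c` have no other point in common.
  obtain ⟨u, hu⟩ := exists_lift_eq hsn
    (isSpaced_steppedSet 0 (t := 0) c hn hr (Nat.zero_le r) : IsSpaced n k s _)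
  obtain ⟨v, hv⟩ := exists_lift_eq hsn (isSpaced_steppedSet 0 (t := 0) (c - (k - 1 : ℕ) * s) hn hr
    (Nat.zero_le r) : IsSpaced n k s _)
  have hcu : c ∈ lift u := by
    rw [hu]
    simpa using mem_steppedSet_of_le (n := n) (k := k) (s := s) (m := 0) (t := 0) c
      (j := 0) (by omega) le_rfl
  have hcv : c ∈ lift v := by
    rw [hv]
    simpa using mem_steppedSet_of_le (n := n) (k := k) (s := s) (m := 0) (t := 0)
      (c - (k - 1 : ℕ) * s) (j := k - 1) (by omega) (Nat.zero_le _)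
  have h₁ := h u hcu
  have h₂ := h v hcv
  rw [hu] at h₁
  rw [hv] at h₂
  obtain ⟨i, hi, p, hp⟩ := h₁
  obtain ⟨j, hj, q, hq⟩ := h₂
  rw [Nat.cast_sub (by omega)] at hq
  simp only [Nat.zero_le, if_true, add_zero, Nat.cast_mul, Nat.cast_one] at hp hq
  have hi' : (i : ℤ) + 1 ≤ k := by exact_mod_cast hi
  have hj' : (j : ℤ) + 1 ≤ k := by exact_mod_cast hj
  have hi0 : (0 : ℤ) ≤ i := by positivity
  have hj0 : (0 : ℤ) ≤ j := by positivity
  have hr' : (r : ℤ) + 1 ≤ s := by exact_mod_cast hr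
  have hr₁' : (1 : ℤ) ≤ r := by exact_mod_cast hr₁
  have hk' : (2 : ℤ) ≤ k := by exact_mod_cast hk
  set D : ℤ := i + k - 1 - j with hD
  have key : D * s = (q - p) * n := by rw [hD]; linarith
  have hs0 : (0 : ℤ) < s := by linarith
  -- `0 ≤ D * s ≤ (2 * k - 2) * s < 2 * n`, and `D * s = n` is impossible modulo `s`.
  have hDs : 0 ≤ D * s := mul_nonneg (by linarith) hs0.le
  have hDs' : D * s ≤ (2 * k - 2) * s := mul_le_mul_of_nonneg_right (by linarith) hs0.le
  generalize q - p = e at key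
  have hks : 0 ≤ (k : ℤ) * s := by positivity
  rcases lt_trichotomy e 0 with he | rfl | he
  · have : e * n ≤ -1 * n := mul_le_mul_of_nonneg_right (by omega) (by positivity)
    nlinarith
  · have : D = 0 := by
      rcases mul_eq_zero.1 (key.trans (zero_mul _)) with h | h
      · exact h
      · omega
    have hi00 : (i : ℤ) = 0 := by linarith
    exact cyc_eq_cyc.2 ⟨p, by rw [hp, hi00]; ring⟩
  · exfalso
    rcases (show e = 1 ∨ 2 ≤ e by omega) with rfl | he
    · have : (D - k) * s = r := by rw [hn'] at key; linarith
      rcases le_or_gt (D - k) 0 with h | h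
      · nlinarith
      · nlinarith
    · have : 2 * (n : ℤ) ≤ e * n := mul_le_mul_of_nonneg_right he (by positivity)
      nlinarith

/-- Every automorphism is induced by a permutation of the cycle. -/
theorem exists_perm (hk : 2 ≤ k) (hn : n = s * k + r) (hr₁ : 1 ≤ r) (hr : r < s)
    (φ : stableKneserGraph n k s ≃g stableKneserGraph n k s) :
    ∃ π : Equiv.Perm (Fin n), ∀ v (i : Fin n), π i ∈ (φ v).1.1 ↔ i ∈ v.1.1 := by
  have key : ∀ ψ : stableKneserGraph n k s ≃g stableKneserGraph n k s, ∃ f : Fin n → Fin n,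
      ∀ i v, i ∈ v.1.1 → f i ∈ (ψ v).1.1 := by
    intro ψ
    have : ∀ i : Fin n, ∃ j : Fin n, ∀ v, i ∈ v.1.1 → j ∈ (ψ v).1.1 := by
      intro i
      obtain ⟨c', hc'⟩ := exists_star_image hk hn hr ψ (i : ℕ)
      refine ⟨cyc n c', fun v hv => hc' v ?_⟩
      rwa [mem_lift, cyc_coe]
    choose f hf using this
    exact ⟨f, hf⟩
  have sub : ∀ i j : Fin n, (∀ v : stableVertices n k s, i ∈ v.1.1 → j ∈ v.1.1) → i = j := by
    intro i j h
    rw [← cyc_coe i, ← cyc_coe j]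
    refine cyc_eq_of_star_subset hk hn hr₁ hr fun v hv => ?_
    rw [mem_lift, cyc_coe] at hv ⊢
    exact h v hv
  obtain ⟨f, hf⟩ := key φ
  obtain ⟨g, hg⟩ := key φ.symm
  have hgf : ∀ i, g (f i) = i := fun i => (sub _ _ fun v hv => by
    simpa using hg _ _ (hf _ _ hv)).symm
  have hfg : ∀ i, f (g i) = i := fun i => (sub _ _ fun v hv => by
    simpa using hf _ _ (hg _ _ hv)).symm
  refine ⟨⟨f, g, hgf, hfg⟩, fun v i => ⟨fun h => ?_, fun h => hf i v h⟩⟩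
  have := hg _ _ h
  simpa [hgf] using this

end Stars

/-! ### Automorphisms are rotations and reflections -/

section Dihedral

variable {n k s r : ℕ}

/-- Some vertex containing `i` remains a vertex when `i` is replaced by `j`. -/
def IsMove (k s : ℕ) (i j : Fin n) : Prop :=
  ∃ u v : stableVertices n k s, i ∈ u.1.1 ∧ j ∈ v.1.1 ∧
    ∀ l, l ∈ u.1.1 ∧ l ≠ i ↔ l ∈ v.1.1 ∧ l ≠ j

theorem IsMove.symm {i j : Fin n} (h : IsMove k s i j) : IsMove k s j i := by
  obtain ⟨u, v, hu, hv, h⟩ := h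
  exact ⟨v, u, hv, hu, fun l => (h l).symm⟩

theorem isMove_perm_iff {φ : stableKneserGraph n k s ≃g stableKneserGraph n k s}
    {π : Equiv.Perm (Fin n)} (hπ : ∀ v (i : Fin n), π i ∈ (φ v).1.1 ↔ i ∈ v.1.1)
    (i j : Fin n) :
    IsMove k s (π i) (π j) ↔ IsMove k s i j := by
  constructor
  · rintro ⟨u, v, hu, hv, h⟩
    obtain ⟨u, rfl⟩ := φ.surjective u
    obtain ⟨v, rfl⟩ := φ.surjective v
    refine ⟨u, v, (hπ u i).1 hu, (hπ v j).1 hv, fun l => ?_⟩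
    simpa [hπ] using h (π l)
  · rintro ⟨u, v, hu, hv, h⟩
    refine ⟨φ u, φ v, (hπ u i).2 hu, (hπ v j).2 hv, fun l => ?_⟩
    obtain ⟨l, rfl⟩ := π.surjective l
    simpa [hπ] using h l

/-- The point `j` is reached by a move from `i`, and only one point is reached from `i` but not
from `j`. This singles out the neighbours of `i` on the cycle. -/
def IsUnitMove (k s : ℕ) (i j : Fin n) : Prop :=
  i ≠ j ∧ IsMove k s i j ∧ ∀ a b, IsMove k s i a → ¬IsMove k s j a → IsMove k s i b →
    ¬IsMove k s j b → a = b

theorem isUnitMove_perm {φ : stableKneserGraph n k s ≃g stableKneserGraph n k s}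
    {π : Equiv.Perm (Fin n)} (hπ : ∀ v (i : Fin n), π i ∈ (φ v).1.1 ↔ i ∈ v.1.1)
    {i j : Fin n} (h : IsUnitMove k s i j) : IsUnitMove k s (π i) (π j) := by
  obtain ⟨hne, hm, hu⟩ := h
  refine ⟨by simpa using hne, (isMove_perm_iff hπ i j).2 hm, fun a b => ?_⟩
  obtain ⟨a, rfl⟩ := π.surjective a
  obtain ⟨b, rfl⟩ := π.surjective b
  simp only [isMove_perm_iff hπ, EmbeddingLike.apply_eq_iff_eq]
  exact hu a b

variable [NeZero n]

theorem cyc_ne_of_lt {x y : ℤ} (h₁ : x < y) (h₂ : y < x + n) : cyc n x ≠ cyc n y := by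
  intro h
  obtain ⟨q, rfl⟩ := cyc_eq_cyc.1 h
  have hn : (0 : ℤ) ≤ n := by positivity
  rcases le_or_gt q 0 with hq | hq
  · have : q * n ≤ 0 * n := mul_le_mul_of_nonneg_right hq hn
    omega
  · have : 1 * n ≤ q * n := mul_le_mul_of_nonneg_right hq hn
    omega

theorem isMove_cyc_add (hk : 0 < k) (hn : n = s * k + r) (hr : r < s) (x : ℤ) {d : ℕ}
    (hd : d ≤ r) : IsMove k s (cyc n x) (cyc n (x + d)) := by
  have hn' : (n : ℤ) = s * k + r := by exact_mod_cast hn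
  have hsn : s ≤ n := by rw [hn]; nlinarith
  obtain ⟨u, hu⟩ := exists_lift_eq hsn
    (isSpaced_steppedSet 1 (t := d) x hn hr hd : IsSpaced n k s _)
  obtain ⟨v, hv⟩ := exists_lift_eq hsn
    (isSpaced_steppedSet 0 (t := 0) (x + d) hn hr (Nat.zero_le r) : IsSpaced n k s _)
  refine ⟨u, v, ?_, ?_, fun l => ?_⟩
  · rw [← mem_lift, hu]
    simpa using mem_steppedSet_of_lt (n := n) (k := k) (s := s) (m := 1) (t := d) x
      (j := 0) hk one_pos
  · rw [← mem_lift, hv]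
    simpa using mem_steppedSet_of_le (n := n) (k := k) (s := s) (m := 0) (t := 0) (x + d)
      (j := 0) hk le_rfl
  · obtain ⟨w, rfl⟩ : ∃ w : ℤ, cyc n w = l := ⟨(l : ℕ), cyc_coe l⟩
    rw [← mem_lift, ← mem_lift, hu, hv]
    have bound : ∀ j : ℕ, j < k → (d + j * s : ℤ) < n ∧ (0 : ℤ) ≤ j * s ∧
        (1 ≤ j → (s : ℤ) ≤ j * s) := by
      intro j hj
      refine ⟨?_, by positivity, fun h => ?_⟩
      · have : (j + 1) * s ≤ k * s := Nat.mul_le_mul_right s hj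
        have : ((j : ℤ) + 1) * s ≤ k * s := by exact_mod_cast this
        have : (d : ℤ) ≤ r := by exact_mod_cast hd
        have : (r : ℤ) < s := by exact_mod_cast hr
        linarith
      · have : 1 * s ≤ j * s := Nat.mul_le_mul_right s h
        rw [one_mul] at this
        exact_mod_cast this
    constructor
    · rintro ⟨⟨j, hj, q, rfl⟩, hne⟩
      have hj₁ : 1 ≤ j := by
        by_contra hc
        obtain rfl : j = 0 := by omega
        exact hne (cyc_eq_cyc.2 ⟨q, by simp⟩).symm
      obtain ⟨b₁, b₂, b₃⟩ := bound j hj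
      have b₄ := b₃ hj₁
      refine ⟨⟨j, hj, q, by simp [hj₁]; ring⟩, fun h => ?_⟩
      refine cyc_ne_of_lt (n := n) (x := x + d) (y := x + d + j * s) (by omega) (by omega) ?_
      rw [← h]
      exact (cyc_eq_cyc.2 ⟨q, by simp [hj₁]; ring⟩).symm
    · rintro ⟨⟨j, hj, q, rfl⟩, hne⟩
      have hj₁ : 1 ≤ j := by
        by_contra hc
        obtain rfl : j = 0 := by omega
        exact hne (cyc_eq_cyc.2 ⟨q, by simp⟩).symm
      obtain ⟨b₁, b₂, b₃⟩ := bound j hj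
      have b₄ := b₃ hj₁
      refine ⟨⟨j, hj, q, by simp [hj₁]; ring⟩, fun h => ?_⟩
      refine cyc_ne_of_lt (n := n) (x := x) (y := x + d + j * s) (by omega) (by omega) ?_
      rw [← h]
      exact (cyc_eq_cyc.2 ⟨q, by simp⟩).symm

/-- A single point of a vertex can be moved exactly by circular distances at most `r`. -/
theorem isMove_iff (hk : 2 ≤ k) (hn : n = s * k + r) (hr : r < s) (x y : ℤ) :
    IsMove k s (cyc n x) (cyc n y) ↔ ∃ z, cyc n z = cyc n y ∧ x - r ≤ z ∧ z ≤ x + r := by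
  constructor
  · rintro ⟨u, v, hu, hv, h⟩
    by_cases hxy : cyc n x = cyc n y
    · exact ⟨x, hxy, by omega, by omega⟩
    have hs : 0 < s := by omega
    have hsn : s ≤ n := by rw [hn]; nlinarith
    have hrn : s + r < n := by rw [hn]; nlinarith
    have U := isSpaced_lift hsn u
    have V := isSpaced_lift hsn v
    have hxv : x ∉ lift v := fun hc => ((h _).2 ⟨hc, hxy⟩).2 rfl
    obtain ⟨p, hp, hp₁, hp₂⟩ := U.exists_prev hs (by omega) hn hu
    have hpv : p ∈ lift v := ((h _).1 ⟨hp, cyc_ne_of_lt (by omega) (by omega)⟩).1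
    -- The successor in `v` of the predecessor of `x` in `u` lies close to `x`.
    obtain ⟨z, hz, hz₁, hz₂⟩ := V.exists_next hs (by omega) hn hpv
    refine ⟨z, ?_, by omega, by omega⟩
    by_contra hzy
    have hzu : z ∈ lift u := ((h _).2 ⟨hz, hzy⟩).1
    rcases lt_trichotomy z x with hlt | rfl | hlt
    · have := U.sep z hzu x hu hlt
      omega
    · exact hxv hz
    · have := U.sep x hu z hzu hlt
      omega
  · rintro ⟨z, hz, h₁, h₂⟩
    rw [← hz]
    rcases le_total x z with h | h
    · obtain ⟨d, hd⟩ := Int.le.dest h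
      rw [← hd]
      exact isMove_cyc_add (by omega) hn hr x (by omega)
    · obtain ⟨d, hd⟩ := Int.le.dest h
      rw [← hd]
      exact (isMove_cyc_add (by omega) hn hr z (by omega)).symm

theorem isUnitMove_succ (hk : 2 ≤ k) (hn : n = s * k + r) (hr₁ : 1 ≤ r) (hr : r < s) (x : ℤ) :
    IsUnitMove k s (cyc n x) (cyc n (x + 1)) := by
  have hn2 : 2 < n := by rw [hn]; nlinarith
  refine ⟨cyc_ne_of_lt (by omega) (by omega),
    (isMove_iff hk hn hr _ _).2 ⟨x + 1, rfl, by omega, by omega⟩, ?_⟩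
  have key : ∀ a, IsMove k s (cyc n x) a → ¬IsMove k s (cyc n (x + 1)) a →
      a = cyc n (x - r) := by
    intro a ha hb
    rw [← cyc_coe a] at ha hb ⊢
    rw [isMove_iff hk hn hr] at ha hb
    obtain ⟨z, hz, h₁, h₂⟩ := ha
    rw [← hz]
    by_contra hne
    have : z ≠ x - r := fun h => hne (by rw [h])
    exact hb ⟨z, hz, by omega, by omega⟩
  intro a b ha hja hb hjb
  rw [key a ha hja, key b hb hjb]

theorem not_isMove_of_far (hk : 2 ≤ k) (hn : n = s * k + r) (hr : r < s) {x y : ℤ}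
    (h₁ : x + r < y) (h₂ : y + r < x + n) : ¬IsMove k s (cyc n x) (cyc n y) := by
  rw [isMove_iff hk hn hr]
  rintro ⟨z, hz, h₃, h₄⟩
  exact cyc_ne_of_lt (by omega) (by omega) hz

theorem eq_of_isUnitMove (hk : 2 ≤ k) (hn : n = s * k + r) (hr : r < s) {x y : ℤ}
    (h : IsUnitMove k s (cyc n x) (cyc n y)) :
    cyc n y = cyc n (x + 1) ∨ cyc n y = cyc n (x - 1) := by
  have hn3 : 3 * r + 1 < n := by rw [hn]; nlinarith
  obtain ⟨hne, hmove, huniq⟩ := h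
  obtain ⟨z, hz, h₁, h₂⟩ := (isMove_iff hk hn hr _ _).1 hmove
  rw [← hz] at hne huniq ⊢
  have hzx : z ≠ x := fun h => hne (by rw [h])
  by_cases e₁ : z = x + 1
  · exact Or.inl (by rw [e₁])
  by_cases e₂ : z = x - 1
  · exact Or.inr (by rw [e₂])
  exfalso
  have near : ∀ w, x - r ≤ w → w ≤ x + r → IsMove k s (cyc n x) (cyc n w) :=
    fun w h₁ h₂ => (isMove_iff hk hn hr _ _).2 ⟨w, rfl, h₁, h₂⟩
  -- The two points at the far end of the range of `x` are out of the range of `z`.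
  rcases lt_or_gt_of_ne hzx with hlt | hlt
  · exact cyc_ne_of_lt (by omega) (by omega) (huniq (cyc n (x + r - 1)) (cyc n (x + r))
      (near _ (by omega) (by omega)) (not_isMove_of_far hk hn hr (by omega) (by omega))
      (near _ (by omega) (by omega)) (not_isMove_of_far hk hn hr (by omega) (by omega)))
  · exact cyc_ne_of_lt (by omega) (by omega) (huniq (cyc n (x - r)) (cyc n (x - r + 1))
      (near _ (by omega) (by omega))
      (fun h => not_isMove_of_far hk hn hr (by omega) (by omega) h.symm)
      (near _ (by omega) (by omega))
      (fun h => not_isMove_of_far hk hn hr (by omega) (by omega) h.symm))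

variable {φ : stableKneserGraph n k s ≃g stableKneserGraph n k s} {π : Equiv.Perm (Fin n)}

/-- The permutation of the cycle induced by an automorphism is a rotation (`ε = 1`) or a
reflection (`ε = -1`). -/
theorem exists_perm_eq_cyc (hk : 2 ≤ k) (hn : n = s * k + r) (hr₁ : 1 ≤ r) (hr : r < s)
    (hπ : ∀ v (i : Fin n), π i ∈ (φ v).1.1 ↔ i ∈ v.1.1) :
    ∃ c : ℕ, c < n ∧ ∃ ε : ℤ, (ε = 1 ∨ ε = -1) ∧ ∀ x : ℤ, π (cyc n x) = cyc n (c + ε * x) := by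
  have hn2 : 2 < n := by rw [hn]; nlinarith
  have step : ∀ x y : ℤ, π (cyc n x) = cyc n y →
      π (cyc n (x + 1)) = cyc n (y + 1) ∨ π (cyc n (x + 1)) = cyc n (y - 1) := by
    intro x y hxy
    have h := isUnitMove_perm hπ (isUnitMove_succ hk hn hr₁ hr x)
    rw [hxy, ← cyc_coe (π (cyc n (x + 1)))] at h
    have := eq_of_isUnitMove hk hn hr h
    rwa [cyc_coe] at this
  set c : ℕ := (π (cyc n 0) : ℕ) with hc
  have h₀ : π (cyc n 0) = cyc n c := (cyc_coe _).symm
  obtain ⟨ε, hε, h₁⟩ : ∃ ε : ℤ, (ε = 1 ∨ ε = -1) ∧ π (cyc n 1) = cyc n (c + ε) := by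
    rcases step 0 c h₀ with h | h
    · exact ⟨1, Or.inl rfl, h⟩
    · exact ⟨-1, Or.inr rfl, h⟩
  refine ⟨c, (π (cyc n 0)).isLt, ε, hε, ?_⟩
  have nat : ∀ x : ℕ, π (cyc n x) = cyc n (c + ε * x) ∧
      π (cyc n (x + 1 : ℕ)) = cyc n (c + ε * (x + 1 : ℕ)) := by
    intro x
    induction x with
    | zero => exact ⟨by simpa using h₀, by simpa using h₁⟩
    | succ x ih =>
      refine ⟨ih.2, ?_⟩
      -- The walk cannot turn back, as `π` is injective.
      have back : π (cyc n ((x + 1 : ℕ) + 1)) ≠ cyc n (c + ε * x) := by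
        rw [← ih.1, Ne, EmbeddingLike.apply_eq_iff_eq]
        exact (cyc_ne_of_lt (by push_cast; omega) (by push_cast; omega)).symm
      have e₁ : (c : ℤ) + ε * (x + 1 : ℕ) = c + ε * x + ε := by push_cast; ring
      have e₂ : (c : ℤ) + ε * (x + 1 + 1 : ℕ) = c + ε * x + ε + ε := by push_cast; ring
      have hs := step _ _ ih.2
      rw [e₁] at hs
      rw [e₂]
      rcases hε with rfl | rfl
      · rcases hs with h | h
        · simpa using h
        · exact absurd (by simpa using h) back
      · rcases hs with h | h
        · exact absurd (by simpa using h) back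
        · simpa [sub_eq_add_neg] using h
  intro x
  have h := (nat (cyc n x)).1
  rw [cyc_coe] at h
  rw [h, coe_cyc, cyc_eq_cyc]
  refine ⟨ε * (x / n), ?_⟩
  have := Int.emod_add_mul_ediv x n
  linear_combination (-ε) * this

end Dihedral

/-! ### Shifts -/

section Shifts

variable {n k s r : ℕ} [NeZero n]

theorem isShift_iff (hk : 0 < k) (φ : stableKneserGraph n k s ≃g stableKneserGraph n k s) :
    (stableKneserGraph n k s).IsShift φ ↔ ∀ v, ∀ x ∈ lift v, x ∉ lift (φ v) :=
  forall_congr' fun v => adj_iff hk v (φ v)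

/-- A rotation is a shift exactly when no vertex contains two points at the distance of the
rotation. -/
theorem isShift_stableRotation_pow_iff (hk : 0 < k) (i : ℕ) :
    (stableKneserGraph n k s).IsShift (stableRotation n k s ^ i) ↔
      ∀ v : stableVertices n k s, ∀ x ∈ lift v, x + i ∉ lift v := by
  rw [isShift_iff hk]
  refine forall_congr' fun v => ?_
  simp only [← zpow_natCast, mem_lift_zpow]
  constructor
  · intro h x hx hi
    exact h _ hi (by simpa using hx)
  · intro h x hx hi
    exact h _ hi (by simpa using hx)

/-- A shift is a rotation: a reflection maps some vertex to one meeting it. -/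
theorem exists_eq_pow_of_isShift (hk : 2 ≤ k) (hn : n = s * k + r) (hr₁ : 1 ≤ r) (hr : r < s)
    {φ : stableKneserGraph n k s ≃g stableKneserGraph n k s}
    (hφ : (stableKneserGraph n k s).IsShift φ) : ∃ i < n, φ = stableRotation n k s ^ i := by
  have hsn : s ≤ n := by rw [hn]; nlinarith
  obtain ⟨π, hπ⟩ := exists_perm hk hn hr₁ hr φ
  obtain ⟨c, hcn, ε, hε, hc⟩ := exists_perm_eq_cyc hk hn hr₁ hr hπ
  have hmem : ∀ v x, c + ε * x ∈ lift (φ v) ↔ x ∈ lift v := by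
    intro v x
    rw [mem_lift, mem_lift, ← hc, hπ]
  rcases hε with rfl | rfl
  · refine ⟨c, hcn, RelIso.ext fun v => lift_injective (Set.ext fun x => ?_)⟩
    rw [← zpow_natCast, mem_lift_zpow, ← hmem v (x - c)]
    ring_nf
  · exfalso
    rw [isShift_iff (by omega)] at hφ
    -- One of the gaps `s`, `s + 1` has the parity of `c`, so the reflection swaps the ends of a
    -- gap of this length.
    obtain ⟨t, ht, a, ha⟩ : ∃ t : ℕ, t ≤ 1 ∧ ∃ a : ℤ, (c : ℤ) = 2 * a + s + t := by
      rcases Int.even_or_odd' ((c : ℤ) - s) with ⟨a, ha | ha⟩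
      · exact ⟨0, by omega, a, by push_cast; omega⟩
      · exact ⟨1, le_rfl, a, by push_cast; omega⟩
    obtain ⟨v, hv⟩ := exists_lift_eq hsn
      (isSpaced_steppedSet 1 (t := t) a hn hr (by omega) : IsSpaced n k s _)
    have h₁ : a ∈ lift v := by
      rw [hv]
      simpa using mem_steppedSet_of_lt (n := n) (k := k) (s := s) (m := 1) (t := t) a
        (j := 0) (by omega) one_pos
    have h₂ : a + s + t ∈ lift v := by
      rw [hv]
      simpa using mem_steppedSet_of_le (n := n) (k := k) (s := s) (m := 1) (t := t) a
        (j := 1) (by omega) le_rfl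
    rw [← hmem, show (c : ℤ) + -1 * (a + s + t) = a by linarith] at h₂
    exact hφ v a h₁ h₂

end Shifts

theorem mainTheorem3 (n k s r : ℕ) (hs : 2 ≤ s) (hk : 2 ≤ k)
    (hn₁ : s * k + 1 ≤ n) (hn₂ : n ≤ s * (k + 1) - 2) (hr : r = n - s * k) :
    {φ : stableKneserGraph n k s ≃g stableKneserGraph n k s |
        (stableKneserGraph n k s).IsShift φ} =
      (fun i : ℕ => stableRotation n k s ^ i) ''
        (Set.Icc 1 (s - 1) ∪ Set.Icc (n - s + 1) (n - 1) ∪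
          ⋃ m ∈ Set.Icc 1 (k - 2), Set.Icc (m * s + r + 1) ((m + 1) * s - 1)) := by
  have : NeZero n := ⟨by omega⟩
  have hn : n = s * k + r := by omega
  have hr₁ : 1 ≤ r := by omega
  have hrs : r < s := by rw [mul_add] at hn₂; omega
  have hsn : s ≤ n := by rw [hn]; nlinarith
  have hks : s * k = (k - 1) * s + s := by
    obtain ⟨k, rfl⟩ : ∃ j, k = j + 1 := ⟨k - 1, by omega⟩
    simp only [Nat.add_sub_cancel]; ring
  ext φ
  simp only [Set.mem_ofPred_eq, Set.mem_image, Set.mem_union, Set.mem_Icc, Set.mem_iUnion,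
    exists_prop]
  constructor
  · intro hφ
    obtain ⟨i, hi, rfl⟩ := exists_eq_pow_of_isShift hk hn hr₁ hrs hφ
    refine ⟨i, ?_, rfl⟩
    rw [isShift_stableRotation_pow_iff (by omega)] at hφ
    have ne_zero : i ≠ 0 := by
      rintro rfl
      obtain ⟨v, -⟩ := exists_lift_eq hsn
        (isSpaced_steppedSet 0 (t := 0) 0 hn hrs (Nat.zero_le r) : IsSpaced n k s _)
      obtain ⟨x, hx, -⟩ := (isSpaced_lift hsn v).exists_mem_window (by omega) (by omega) hn 0
      exact hφ v x hx (by simpa using hx)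
    -- Every distance in `[m * s, m * s + r]` with `1 ≤ m < k` occurs in a stepped set.
    have avoid : ∀ m < k, 0 < m → ∀ t ≤ r, i ≠ m * s + t := by
      rintro m hm hm₀ t ht rfl
      obtain ⟨v, hv⟩ := exists_lift_eq hsn
        (isSpaced_steppedSet m (t := t) 0 hn hrs ht : IsSpaced n k s _)
      refine hφ v 0 ?_ ?_
      · rw [hv]
        simpa using mem_steppedSet_of_lt (n := n) (k := k) (s := s) (m := m) (t := t) 0
          (j := 0) (by omega) hm₀
      · rw [hv]
        simpa using mem_steppedSet_of_le (n := n) (k := k) (s := s) (m := m) (t := t) 0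
          (j := m) hm le_rfl
    have hdiv := Nat.div_add_mod' i s
    have hmod := Nat.mod_lt i (show 0 < s by omega)
    generalize i / s = m at hdiv
    generalize i % s = t at hdiv hmod
    rcases Nat.eq_zero_or_pos m with rfl | hm₀
    · left; left; omega
    rcases le_or_gt k m with hkm | hkm
    · have := Nat.mul_le_mul_right s hkm
      rw [mul_comm k s] at this
      left; right; omega
    have hrt : r < t := by
      by_contra hc
      exact avoid m hkm hm₀ t (by omega) hdiv.symm
    rcases (show m = k - 1 ∨ m ≤ k - 2 by omega) with rfl | hmk
    · left; right; omega
    · right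
      refine ⟨m, ⟨hm₀, hmk⟩, by omega, ?_⟩
      rw [add_mul]
      omega
  · rintro ⟨i, hi, rfl⟩
    rw [isShift_stableRotation_pow_iff (by omega)]
    intro v x hx hxi
    have hi₀ : 0 < i ∧ i < n := by
      rcases hi with (hi | hi) | ⟨m, hm, hi⟩
      · omega
      · omega
      · have := Nat.mul_le_mul_right s (show m + 1 ≤ k - 1 by omega)
        omega
    obtain ⟨m, hm₁, hmk, h₁, h₂⟩ := (isSpaced_lift hsn v).exists_steps (by omega) hn hx hxi
      (by omega) (by omega)
    have h₁ : m * s ≤ i := by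
      rw [add_sub_cancel_left] at h₁
      exact_mod_cast h₁
    have h₂ : i ≤ m * s + r := by
      rw [add_sub_cancel_left] at h₂
      exact_mod_cast h₂
    rcases hi with (hi | hi) | ⟨p, hp, hi⟩
    · have := Nat.mul_le_mul_right s hm₁
      omega
    · have := Nat.mul_le_mul_right s (show m ≤ k - 1 by omega)
      omega
    · rcases le_or_gt m p with hmp | hmp
      · have := Nat.mul_le_mul_right s hmp
        omega
      · have := Nat.mul_le_mul_right s (show p + 1 ≤ m from hmp)
        omega
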